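/- All graphs are finite, simple and have at least one vertex. A set of vertices is stable if its vertices are pairwise non-adjacent; $\alpha(G)$ is the maximum cardinality of a stable set of $G$, $s_k$ is the number of stable sets of $G$ of cardinality $k$, and $I(G;x)=s_0+s_1x+\dots+s_{\alpha(G)}x^{\alpha(G)}$ is the independence polynomial of $G$. A graph is well-covered if all its inclusion-maximal stable sets have the same cardinality; it is very well-covered if in addition it has no isolated vertices and has exactly $2\alpha(G)$ vertices. The girth of $G$ is the length of a shortest cycle, and is $\infty$ if $G$ has no cycle. For a graph $H$ and $q\ge 0$, $qH$ denotes the disjoint union of $q$ copies of $H$, and $\cup$ denotes disjoint union. (i) If $G$ is a well-covered graph of girth at least $6$ that is not isomorphic to $pK_2\cup qC_7$ for any integers $p,q\ge 0$ with $p+q\ge 1$, then $I(G;-1)=0$, i.e. the number of stable sets of even cardinality of $G$ equals the number of its stable sets of odd cardinality. (ii) If $G$ is a very well-covered graph of girth at least $5$ that is not isomorphic to $qK_2$ for any $q\ge 1$, then $I(G;-1)=0$, i.e. the number of stable sets of even cardinality of $G$ equals the number of its stable sets of odd cardinality. (iii) In particular, for every well-covered tree $T$ not isomorphic to $K_2$,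 $I(T;-1)=0$, i.e. the number of stable sets of even cardinality of $T$ equals the number of its stable sets of odd cardinality. -/

import Mathlib

namespace StableSets

open Polynomial

/-- `G` is well-covered: all its maximal (with respect to inclusion) stable sets have the same
cardinality. -/
def WellCovered {V : Type*} [Fintype V] (G : SimpleGraph V) : Prop :=
  ∀ s t : Finset V, Maximal G.IsIndepSet (s : Set V) → Maximal G.IsIndepSet (t : Set V) →
    s.card = t.card

/-- `G` is very well-covered: it is well-covered, has no isolated vertices, and its order is twice
its stability number. -/
def VeryWellCovered {V : Type*} [Fintype V] (G : SimpleGraph V) : Prop :=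
  WellCovered G ∧ (∀ v, ∃ w, G.Adj v w) ∧ Fintype.card V = 2 * G.indepNum

open Classical in
/-- The number `s_k` of stable sets of cardinality `k`. -/
noncomputable def stableCount {V : Type*} [Fintype V] (G : SimpleGraph V) (k : ℕ) : ℕ :=
  (G.indepSetFinset k).card

/-- The independence polynomial `I(G; x) = s_0 + s_1 x + ... + s_α x ^ α`, where `α` is the
stability number of `G`. -/
noncomputable def indepPoly {V : Type*} [Fintype V] (G : SimpleGraph V) : ℤ[X] :=
  ∑ k ∈ Finset.range (G.indepNum + 1), C (stableCount G k : ℤ) * X ^ k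

open Classical in
/-- The number of stable sets of even cardinality. -/
noncomputable def evenStableCount {V : Type*} [Fintype V] (G : SimpleGraph V) : ℕ :=
  (Finset.univ.filter fun s : Finset V => G.IsIndepSet (s : Set V) ∧ Even s.card).card

open Classical in
/-- The number of stable sets of odd cardinality. -/
noncomputable def oddStableCount {V : Type*} [Fintype V] (G : SimpleGraph V) : ℕ :=
  (Finset.univ.filter fun s : Finset V => G.IsIndepSet (s : Set V) ∧ Odd s.card).card

/-- The disjoint union `qG` of `q` copies of the graph `G` (the graph without vertices if
`q = 0`). -/
def copies {V : Type*} (q : ℕ) (G : SimpleGraph V) : SimpleGraph (Fin q × V) where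
  Adj x y := x.1 = y.1 ∧ G.Adj x.2 y.2
  symm := ⟨fun _ _ h => ⟨h.1.symm, h.2.symm⟩⟩
  loopless := ⟨fun _ h => G.loopless.irrefl _ h.2⟩

end StableSets

/-! The signed count of stable sets vanishes as soon as a vertex can be toggled without destroying
stability (`even_eq_odd_of_toggle`). An isolated vertex can always be toggled. If `u` has a leaf `l`
and a neighbour `y` with a leaf `k ≠ u`, toggle `k` when `u` is in the set (then `y` is not) and `l`
otherwise (`even_eq_odd_of_adj_leaf`).

It remains to see that such a configuration is missing only in the excluded graphs. Suppose every
vertex is isolated, a leaf, next to a leaf, or on a component `C₇` (`Good`). In a well-covered graph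
no vertex has two leaves (`WellCoveredOn.leaf_unique`), so if neither toggle is available, every
edge at a leaf is a whole component, and the components are `K₂` and `C₇`
(`even_eq_odd_or_components`).

For girth at least 6, `Good` is proved by induction on the number of vertices
(`good_of_wellCoveredOn`), since deleting a closed neighbourhood preserves well-coveredness. For
very well-covered graphs of girth at least 5, it comes from a perfect matching in which every edge
has a leaf as an end (`VeryWellCovered.isLeaf_or`). A tree has infinite girth, so the first case
applies. -/

namespace StableSets

/-! ### Excluding cycles of length three, four and five. -/

section ShortCycles

variable {V : Type*} {G : SimpleGraph V}

theorem not_adj_of_four_le_egirth (h : 4 ≤ G.egirth) {a b c : V} (hab : G.Adj a b)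
    (hbc : G.Adj b c) : ¬ G.Adj c a := by
  intro hca
  have hc : (SimpleGraph.Walk.cons hab (.cons hbc (.cons hca .nil))).IsCycle := by
    simp [SimpleGraph.Walk.cons_isCycle_iff, hab.ne, hbc.ne, hca.ne, hab.ne', hca.ne']
  have := SimpleGraph.le_egirth.1 h _ _ hc
  simp only [SimpleGraph.Walk.length_cons, SimpleGraph.Walk.length_nil] at this
  exact absurd this (by decide)

theorem eq_of_five_le_egirth (h : 5 ≤ G.egirth) {a b c d : V} (hab : G.Adj a b)
    (hbc : G.Adj b c) (hcd : G.Adj c d) (hda : G.Adj d a) (hac : a ≠ c) : b = d := by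
  by_contra hbd
  have hc : (SimpleGraph.Walk.cons hab (.cons hbc (.cons hcd (.cons hda .nil)))).IsCycle := by
    simp [SimpleGraph.Walk.cons_isCycle_iff, hab.ne, hbc.ne, hcd.ne, hda.ne, hab.ne', hda.ne',
      hac, hbd, hac.symm]
  have := SimpleGraph.le_egirth.1 h _ _ hc
  simp only [SimpleGraph.Walk.length_cons, SimpleGraph.Walk.length_nil] at this
  exact absurd this (by decide)

/-- No distinctness is needed: a closed walk of length five that repeats a vertex contains a
triangle. -/
theorem not_adj_of_six_le_egirth (h : 6 ≤ G.egirth) {a b c d e : V} (hab : G.Adj a b)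
    (hbc : G.Adj b c) (hcd : G.Adj c d) (hde : G.Adj d e) : ¬ G.Adj e a := by
  intro hea
  have h4 : 4 ≤ G.egirth := le_trans (by decide) h
  have hac : a ≠ c := by rintro rfl; exact not_adj_of_four_le_egirth h4 hcd hde hea
  have had : a ≠ d := by rintro rfl; exact not_adj_of_four_le_egirth h4 hab hbc hcd
  have hbd : b ≠ d := by rintro rfl; exact not_adj_of_four_le_egirth h4 hab hde hea
  have hbe : b ≠ e := by rintro rfl; exact not_adj_of_four_le_egirth h4 hbc hcd hde
  have hce : c ≠ e := by rintro rfl; exact not_adj_of_four_le_egirth h4 hab hbc hea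
  have hc : (SimpleGraph.Walk.cons hab
      (.cons hbc (.cons hcd (.cons hde (.cons hea .nil))))).IsCycle := by
    simp [SimpleGraph.Walk.cons_isCycle_iff, hab.ne, hbc.ne, hcd.ne, hde.ne, hea.ne, hab.ne',
      hea.ne', hac, had, hbd, hbe, hce, hac.symm, had.symm]
  have := SimpleGraph.le_egirth.1 h _ _ hc
  simp only [SimpleGraph.Walk.length_cons, SimpleGraph.Walk.length_nil] at this
  exact absurd this (by decide)

/-- `G` contains no cycle of length at most five. -/
structure NoShortCycle (G : SimpleGraph V) : Prop where
  tri : ∀ ⦃a b c⦄, G.Adj a b → G.Adj b c → ¬ G.Adj c a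
  quad : ∀ ⦃a b c d⦄, G.Adj a b → G.Adj b c → G.Adj c d → G.Adj d a → a ≠ c → b = d
  pent : ∀ ⦃a b c d e⦄, G.Adj a b → G.Adj b c → G.Adj c d → G.Adj d e → ¬ G.Adj e a

theorem noShortCycle_of_six_le_egirth (h : 6 ≤ G.egirth) : NoShortCycle G where
  tri _ _ _ := not_adj_of_four_le_egirth (le_trans (by decide) h)
  quad _ _ _ _ := eq_of_five_le_egirth (le_trans (by decide) h)
  pent _ _ _ _ _ := not_adj_of_six_le_egirth h

end ShortCycles

/-! ### Well-coveredness, leaves and 7-cycles relative to a vertex set `U` of a fixed graph. -/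

section WellCoveredOn

variable {V : Type*} {G : SimpleGraph V} {U s t : Finset V} {u v w l : V}

/-- `s` is a maximal stable set of the subgraph of `G` induced by `U`. -/
def IsMaxStableIn (G : SimpleGraph V) (U s : Finset V) : Prop :=
  s ⊆ U ∧ G.IsIndepSet (s : Set V) ∧ ∀ x ∈ U, x ∉ s → ∃ y ∈ s, G.Adj x y

/-- The subgraph of `G` induced by `U` is well-covered. -/
def WellCoveredOn (G : SimpleGraph V) (U : Finset V) : Prop :=
  ∀ s t : Finset V, IsMaxStableIn G U s → IsMaxStableIn G U t → s.card = t.card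

open Classical in
/-- `U` with the closed neighbourhood of `v` deleted. -/
noncomputable def del (G : SimpleGraph V) (U : Finset V) (v : V) : Finset V :=
  U.filter fun w => w ≠ v ∧ ¬ G.Adj v w

theorem mem_del : w ∈ del G U v ↔ w ∈ U ∧ w ≠ v ∧ ¬ G.Adj v w := by simp [del]

theorem del_subset : del G U v ⊆ U := fun _ h => (mem_del.1 h).1

theorem card_del_lt (hv : v ∈ U) : (del G U v).card < U.card :=
  Finset.card_lt_card ⟨del_subset, fun h => (mem_del.1 (h hv)).2.1 rfl⟩

theorem isIndepSet_insert [DecidableEq V] (hs : G.IsIndepSet (s : Set V))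
    (h : ∀ w ∈ s, ¬ G.Adj v w) : G.IsIndepSet ((insert v s : Finset V) : Set V) := by
  intro a ha b hb hab hadj
  simp only [Finset.coe_insert, Set.mem_insert_iff, Finset.mem_coe] at ha hb
  rcases ha with rfl | ha <;> rcases hb with rfl | hb
  · exact hab rfl
  · exact h b hb hadj
  · exact h a ha hadj.symm
  · exact hs ha hb hab hadj

theorem exists_isMaxStableIn (ht : t ⊆ U) (hi : G.IsIndepSet (t : Set V)) :
    ∃ s, t ⊆ s ∧ IsMaxStableIn G U s := by
  classical
  have hfin : {s : Finset V | s ⊆ U ∧ G.IsIndepSet (s : Set V)}.Finite :=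
    (U.powerset.finite_toSet).subset fun s hs => by simpa using hs.1
  obtain ⟨s, hts, hs⟩ := hfin.exists_le_maximal (a := t) ⟨ht, hi⟩
  refine ⟨s, hts, hs.1.1, hs.1.2, fun x hx hxs => ?_⟩
  by_contra! hc
  exact hxs (hs.2 ⟨Finset.insert_subset hx hs.1.1, isIndepSet_insert hs.1.2 hc⟩
    (Finset.subset_insert x s) (Finset.mem_insert_self x s))

theorem WellCoveredOn.card_le (h : WellCoveredOn G U) (ht : t ⊆ U)
    (hi : G.IsIndepSet (t : Set V)) (hs : IsMaxStableIn G U s) : t.card ≤ s.card := by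
  obtain ⟨s', h1, h2⟩ := exists_isMaxStableIn ht hi
  exact (Finset.card_le_card h1).trans (h _ _ h2 hs).le

/-- Adding `v` turns maximal stable sets of the remainder into maximal stable sets of `U`. This is
what makes induction possible. -/
theorem WellCoveredOn.del (h : WellCoveredOn G U) (hv : v ∈ U) : WellCoveredOn G (del G U v) := by
  classical
  have key : ∀ s, IsMaxStableIn G (StableSets.del G U v) s → IsMaxStableIn G U (insert v s) := by
    intro s ⟨h1, h2, h3⟩
    refine ⟨Finset.insert_subset hv (h1.trans del_subset),
      isIndepSet_insert h2 fun w hw => (mem_del.1 (h1 hw)).2.2, fun x hx hxs => ?_⟩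
    rw [Finset.mem_insert, not_or] at hxs
    by_cases hvx : G.Adj v x
    · exact ⟨v, Finset.mem_insert_self _ _, hvx.symm⟩
    · obtain ⟨y, hy, hxy⟩ := h3 x (mem_del.2 ⟨hx, hxs.1, hvx⟩) hxs.2
      exact ⟨y, Finset.mem_insert_of_mem hy, hxy⟩
  have hnot : ∀ s, IsMaxStableIn G (StableSets.del G U v) s → v ∉ s := fun s hs hvs =>
    (mem_del.1 (hs.1 hvs)).2.1 rfl
  intro s t hs ht
  have := h _ _ (key s hs) (key t ht)
  rwa [Finset.card_insert_of_notMem (hnot s hs), Finset.card_insert_of_notMem (hnot t ht),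
    Nat.add_right_cancel_iff] at this

/-- `l` is a leaf, with neighbour `u`, of the subgraph induced by `U`. -/
structure IsLeaf (G : SimpleGraph V) (U : Finset V) (l u : V) : Prop where
  mem : l ∈ U
  mem' : u ∈ U
  adj : G.Adj l u
  eq : ∀ w ∈ U, G.Adj l w → w = u

/-- In a maximal stable set containing `u`, trading `u` for two leaves at `u` would give a larger
stable set. -/
theorem WellCoveredOn.leaf_unique (h : WellCoveredOn G U) (hl : IsLeaf G U l u)
    (hv : IsLeaf G U v u) : l = v := by
  classical
  by_contra hne
  obtain ⟨s, hus, hs⟩ := exists_isMaxStableIn (G := G) (U := U) (t := {u})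
    (by simpa using hl.mem') (by simp)
  have hu : u ∈ s := hus (Finset.mem_singleton_self u)
  have hls : l ∉ s := fun hls => hs.2.1 hls hu hl.adj.ne hl.adj
  have hvs : v ∉ s := fun hvs => hs.2.1 hvs hu hv.adj.ne hv.adj
  have hle := h.card_le (t := insert l (insert v (s.erase u))) (s := s) ?_ ?_ hs
  · rw [Finset.card_insert_of_notMem (by simp [hne, hls]),
      Finset.card_insert_of_notMem (by simp [hvs]), Finset.card_erase_of_mem hu] at hle
    have := Finset.card_pos.2 ⟨u, hu⟩
    omega
  · exact Finset.insert_subset hl.mem (Finset.insert_subset hv.mem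
      ((Finset.erase_subset _ _).trans hs.1))
  · have hsub : ((s.erase u : Finset V) : Set V) ⊆ s := by simp
    refine isIndepSet_insert (isIndepSet_insert (hs.2.1.mono hsub) ?_) ?_
    · intro w hw hadj
      exact (Finset.mem_erase.1 hw).1 (hv.eq w (hs.1 (Finset.mem_erase.1 hw).2) hadj)
    · intro w hw hadj
      rcases Finset.mem_insert.1 hw with rfl | hw
      · exact hv.adj.ne (hl.eq w hv.mem hadj)
      · exact (Finset.mem_erase.1 hw).1 (hl.eq w (hs.1 (Finset.mem_erase.1 hw).2) hadj)

/-- `v` lies on a 7-cycle that is a connected component of the subgraph induced by `U`. -/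
def InSevenCycle (G : SimpleGraph V) (U : Finset V) (v : V) : Prop :=
  ∃ c : Fin 7 → V, Function.Injective c ∧ (∀ i, c i ∈ U) ∧
    (∀ i, ∀ w ∈ U, G.Adj (c i) w ↔ w = c (i + 1) ∨ w = c (i + 6)) ∧ c 0 = v

/-- The numbering of the cycle can be rotated. In `Fin 7`, adding 6 is stepping back by one. -/
theorem InSevenCycle.of_adj (h : InSevenCycle G U v) (hw : w ∈ U) (hadj : G.Adj v w) :
    InSevenCycle G U w := by
  obtain ⟨c, hinj, hU, hc, rfl⟩ := h
  have hrot : ∀ k, InSevenCycle G U (c k) := fun k => by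
    refine ⟨fun i => c (i + k), hinj.comp (add_left_injective k), fun i => hU _, fun i w hw => ?_,
      by simp⟩
    rw [hc _ w hw, add_right_comm, add_right_comm i k]
  rcases (hc 0 w hw).1 hadj with rfl | rfl <;> exact hrot _

theorem InSevenCycle.not_isLeaf (h : InSevenCycle G U v) : ¬ IsLeaf G U v u := by
  obtain ⟨c, hinj, hU, hc, rfl⟩ := h
  intro hl
  have h1 := hl.eq _ (hU _) ((hc 0 _ (hU _)).2 (Or.inl rfl))
  have h2 := hl.eq _ (hU _) ((hc 0 _ (hU _)).2 (Or.inr rfl))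
  exact absurd (hinj (h1.trans h2.symm)) (by decide)

/-- In the subgraph induced by `U`, the vertex `v` is isolated, or a leaf, or next to a leaf, or on
a 7-cycle that is a component. -/
def Good (G : SimpleGraph V) (U : Finset V) (v : V) : Prop :=
  (∀ w ∈ U, ¬ G.Adj v w) ∨ (∃ u, IsLeaf G U v u) ∨ (∃ l, IsLeaf G U l v) ∨ InSevenCycle G U v

end WellCoveredOn

/-! ### Structure of well-covered graphs without cycles of length at most five. -/

section Structure

variable {V : Type*} {G : SimpleGraph V} {U : Finset V} {x v l u y z a b c₁ c₂ c₃ c₄ c₅ : V}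

/-- The only neighbours of `c₃` are `c₂` and `c₄`, and each of these has a further neighbour. A
7-cycle component through `c₃` would contain the leaf `c₁`. -/
theorem IsLeaf.not_good_of_path (hl : IsLeaf G U c₁ c₂) (h₄ : c₄ ∈ U) (h₅ : c₅ ∈ U)
    (h₂₃ : G.Adj c₂ c₃) (h₃₄ : G.Adj c₃ c₄) (h₄₅ : G.Adj c₄ c₅) (h₁₃ : c₁ ≠ c₃) (h₂₄ : c₂ ≠ c₄)
    (h₃₅ : c₃ ≠ c₅) (heq : ∀ w ∈ U, G.Adj c₃ w → w = c₂ ∨ w = c₄) : ¬ Good G U c₃ := by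
  rintro (h | ⟨w, h⟩ | ⟨w, h⟩ | h)
  · exact h _ h₄ h₃₄
  · exact h₂₄ ((h.eq _ hl.mem' h₂₃.symm).trans (h.eq _ h₄ h₃₄).symm)
  · rcases heq w h.mem h.adj.symm with rfl | rfl
    · exact h₁₃ (h.eq _ hl.mem hl.adj.symm)
    · exact h₃₅ (h.eq _ h₅ h₄₅).symm
  · exact ((h.of_adj hl.mem' h₂₃.symm).of_adj hl.mem hl.adj.symm).not_isLeaf hl

/-- If the cycle were attached to a neighbour `u` of `x`, deleting the closed neighbourhood of `u`
instead would cut the cycle into a path with a vertex that is not `Good`. -/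
theorem InSevenCycle.of_del (hG : NoShortCycle G)
    (ih : ∀ x ∈ U, ∀ w ∈ del G U x, Good G (del G U x) w) (hx : x ∈ U) (h : InSevenCycle G (del G U x) v) : InSevenCycle G U v := by
  obtain ⟨c, hinj, hU, hc, rfl⟩ := h
  have claim : ∀ i, ∀ u ∈ U, G.Adj x u → ¬ G.Adj (c i) u := by
    intro i u hu hxu hiu
    obtain ⟨d, hd⟩ : ∃ d : Fin 7 → V, d = fun k => c (i + k) := ⟨_, rfl⟩
    have dinj : Function.Injective d := by rw [hd]; exact hinj.comp (add_right_injective i)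
    have dU : ∀ k, d k ∈ del G U x := fun k => by rw [hd]; exact hU _
    have dc : ∀ k, ∀ w ∈ del G U x, G.Adj (d k) w ↔ w = d (k + 1) ∨ w = d (k + 6) := by
      intro k w hw
      simp only [hd]
      rw [hc _ w hw, add_assoc, add_assoc]
    have d0u : G.Adj (d 0) u := by simpa [hd] using hiu
    have dadj : ∀ k, G.Adj (d k) (d (k + 1)) := fun k => (dc k _ (dU _)).2 (Or.inl rfl)
    have e01 : G.Adj (d 0) (d 1) := dadj 0
    have e12 : G.Adj (d 1) (d 2) := dadj 1
    have e23 : G.Adj (d 2) (d 3) := dadj 2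
    have e34 : G.Adj (d 3) (d 4) := dadj 3
    have e45 : G.Adj (d 4) (d 5) := dadj 4
    have e56 : G.Adj (d 5) (d 6) := dadj 5
    have e60 : G.Adj (d 6) (d 0) := dadj 6
    have dne : ∀ i j, i ≠ j → d i ≠ d j := fun i j hij => dinj.ne hij
    have dne_u : ∀ k, d k ≠ u := fun k hk => (mem_del.1 (dU k)).2.2 (hk ▸ hxu)
    -- Two adjacent vertices cannot both be attached to neighbours of `x`: a closed walk of length
    -- five through `x` would arise.
    have stab : ∀ p q u' u'', G.Adj x u' → G.Adj x u'' → G.Adj p u' → G.Adj q u'' → ¬ G.Adj p q :=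
      fun p q u' u'' h1 h2 h3 h4 h5 => hG.pent h1 h3.symm h5 h4 h2.symm
    have n1 : ¬ G.Adj u (d 1) := fun h => stab _ _ u u hxu hxu d0u h.symm e01
    have n6 : ¬ G.Adj u (d 6) := fun h => stab _ _ u u hxu hxu h.symm d0u e60
    have n2 : ¬ G.Adj u (d 2) := fun h =>
      dne_u 1 (hG.quad e01 e12 h.symm d0u.symm (dne 0 2 (by decide)))
    have n5 : ¬ G.Adj u (d 5) := fun h =>
      dne_u 6 (hG.quad e60.symm e56.symm h.symm d0u.symm (dne 0 5 (by decide)))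
    have n3 : ¬ G.Adj u (d 3) := fun h => hG.pent d0u.symm e01 e12 e23 h.symm
    have n4 : ¬ G.Adj u (d 4) := fun h => hG.pent d0u.symm e60.symm e56.symm e45.symm h.symm
    have memW : ∀ k, ¬ G.Adj u (d k) → d k ∈ del G U u := fun k hk =>
      mem_del.2 ⟨del_subset (dU k), dne_u k, hk⟩
    have nbr : ∀ k, (∀ u', G.Adj x u' → ¬ G.Adj (d k) u') → ∀ w ∈ del G U u, G.Adj (d k) w →
        w = d (k + 1) ∨ w = d (k + 6) := by
      intro k hk w hw hadj
      refine (dc k w (mem_del.2 ⟨del_subset hw, ?_, fun hxw => hk w hxw hadj⟩)).1 hadj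
      rintro rfl
      exact (mem_del.1 (dU k)).2.2 hadj.symm
    have l1 : IsLeaf G (del G U u) (d 1) (d 2) := by
      refine ⟨memW 1 n1, memW 2 n2, e12, fun w hw hadj => ?_⟩
      rcases nbr 1 (fun u' hu' h => stab _ _ u u' hxu hu' d0u h e01) w hw hadj with h | h
      · exact h
      · exact absurd (h ▸ d0u.symm : G.Adj u w) (mem_del.1 hw).2.2
    have l6 : IsLeaf G (del G U u) (d 6) (d 5) := by
      refine ⟨memW 6 n6, memW 5 n5, e56.symm, fun w hw hadj => ?_⟩
      rcases nbr 6 (fun u' hu' h => stab _ _ u u' hxu hu' d0u h e60.symm) w hw hadj with h | h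
      · exact absurd (h ▸ d0u.symm : G.Adj u w) (mem_del.1 hw).2.2
      · exact h
    -- By `stab`, one of `d 3`, `d 4` is not attached to a neighbour of `x`. That vertex is the
    -- middle of a forbidden path, starting at the leaf `d 1` or `d 6` respectively.
    by_cases h3 : ∀ u', G.Adj x u' → ¬ G.Adj (d 3) u'
    · exact l1.not_good_of_path (memW 4 n4) (memW 5 n5) e23 e34 e45
        (dne 1 3 (by decide)) (dne 2 4 (by decide)) (dne 3 5 (by decide))
        (fun w hw hadj => (nbr 3 h3 w hw hadj).symm) (ih u hu _ (memW 3 n3))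
    · push Not at h3
      obtain ⟨u', hxu', h3u'⟩ := h3
      have h4 : ∀ u', G.Adj x u' → ¬ G.Adj (d 4) u' := fun u'' h1 h2 =>
        stab _ _ u' u'' hxu' h1 h3u' h2 e34
      exact l6.not_good_of_path (memW 3 n3) (memW 2 n2) e45.symm e34.symm e23.symm
        (dne 6 4 (by decide)) (dne 5 3 (by decide)) (dne 4 2 (by decide))
        (nbr 4 h4) (ih u hu _ (memW 4 n4))
  refine ⟨c, hinj, fun i => del_subset (hU i), fun i w hw => ⟨fun hadj => ?_, ?_⟩, rfl⟩
  · refine (hc i w (mem_del.2 ⟨hw, ?_, fun hxw => claim i w hw hxw hadj⟩)).1 hadj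
    rintro rfl
    exact (mem_del.1 (hU i)).2.2 hadj.symm
  · rintro (rfl | rfl)
    · exact (hc i _ (hU _)).2 (Or.inl rfl)
    · exact (hc i _ (hU _)).2 (Or.inr rfl)

/-- If `z` is a leaf at `y` after deletion of a pendant edge `lu` with `u` adjacent to `z`, then
`y` is a leaf. -/
theorem isLeaf_swap_of_del (hG : NoShortCycle G)
    (ih : ∀ x ∈ U, ∀ w ∈ del G U x, Good G (del G U x) w) (hU : WellCoveredOn G U)
    (hl : IsLeaf G U l u) (hz : IsLeaf G (del G U l) z y) (hzu : G.Adj u z) : IsLeaf G U y z := by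
  have mem : ∀ w, w ∈ del G U l ↔ w ∈ U ∧ w ≠ l ∧ w ≠ u := by
    intro w
    rw [mem_del]
    refine and_congr_right fun hw => and_congr_right fun _ => not_congr ⟨hl.eq w hw, ?_⟩
    rintro rfl
    exact hl.adj
  have hzU := (mem _).1 hz.mem
  have hyU := (mem _).1 hz.mem'
  have huy : ¬ G.Adj u y := fun h => hG.tri hzu hz.adj h.symm
  have hleaf : ∀ w ∈ U, G.Adj w l → w = u := fun w hw h => hl.eq w hw h.symm
  -- Any further neighbour `w` of `y` has a leaf of its own, since `y` already has the leaf `z`.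
  -- That leaf is not adjacent to `u`, which would close a 5-cycle, so it survives the deletion
  -- around `u`.
  have key : ∀ w ∈ U, G.Adj y w → w ≠ z →
      w ∈ del G U u ∧ ∃ k, IsLeaf G (del G U u) k w ∧ k ≠ y := by
    intro w hw hyw hwz
    have hwu : w ≠ u := by rintro rfl; exact huy hyw.symm
    have hwl : w ≠ l := by rintro rfl; exact hyU.2.2 (hleaf y hyU.1 hyw)
    have hwU' : w ∈ del G U l := (mem _).2 ⟨hw, hwl, hwu⟩
    have huw : ¬ G.Adj u w := fun h => hwz (hG.quad hzu hz.adj hyw h.symm hyU.2.2.symm).symm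
    refine ⟨mem_del.2 ⟨hw, hwu, huw⟩, ?_⟩
    rcases ih l hl.mem w hwU' with h | ⟨t, h⟩ | ⟨k, h⟩ | h
    · exact absurd hyw.symm (h _ hz.mem')
    · obtain rfl := h.eq _ hz.mem' hyw.symm
      exact absurd ((hU.del hl.mem).leaf_unique h hz) hwz
    · have hky : k ≠ y := by
        rintro rfl
        exact hwz (h.eq _ hz.mem hz.adj.symm).symm
      have hkz : k ≠ z := by
        rintro rfl
        exact hyw.ne (hz.eq w h.mem' h.adj).symm
      have huk : ¬ G.Adj u k := fun hk => hG.pent hzu hz.adj hyw h.adj.symm hk.symm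
      have hkU := (mem _).1 h.mem
      refine ⟨k, ⟨mem_del.2 ⟨hkU.1, hkU.2.2, huk⟩, mem_del.2 ⟨hw, hwu, huw⟩, h.adj,
        fun t ht hkt => h.eq t ((mem _).2 ⟨del_subset ht, ?_, (mem_del.1 ht).2.1⟩) hkt⟩, hky⟩
      rintro rfl
      exact hkU.2.2 (hleaf k hkU.1 hkt)
    · exact absurd hz ((h.of_adj hz.mem' hyw.symm).of_adj hz.mem hz.adj.symm).not_isLeaf
  refine ⟨hyU.1, hzU.1, hz.adj.symm, fun w hw hyw => ?_⟩
  by_contra hwz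
  obtain ⟨hwW, k, hk, hky⟩ := key w hw hyw hwz
  have hyW : y ∈ del G U u := mem_del.2 ⟨hyU.1, hyU.2.2, huy⟩
  -- With `z` gone, `y` is not `Good`: as a leaf it would be a second leaf at `w`, and by `key` none
  -- of its neighbours is a leaf.
  rcases ih u hl.mem' y hyW with h | ⟨t, h⟩ | ⟨t, h⟩ | h
  · exact h w hwW hyw
  · obtain rfl := h.eq _ hwW hyw
    exact hky ((hU.del hl.mem').leaf_unique hk h)
  · have htz : t ≠ z := by
      rintro rfl
      exact (mem_del.1 h.mem).2.2 hzu
    obtain ⟨-, k', hk', hky'⟩ := key t (del_subset h.mem) h.adj.symm htz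
    exact hky' (h.eq _ hk'.mem hk'.adj.symm)
  · exact ((h.of_adj hwW hyw).of_adj hk.mem hk.adj.symm).not_isLeaf hk

/-- Deleting around `l` removes only `l` and `u`, so `Good` lifts directly unless the leaf found is
adjacent to `u`. In that case `isLeaf_swap_of_del` exchanges the roles of the two ends. -/
theorem good_of_isLeaf (hG : NoShortCycle G)
    (ih : ∀ x ∈ U, ∀ w ∈ del G U x, Good G (del G U x) w) (hU : WellCoveredOn G U)
    (hl : IsLeaf G U l u) (hz : z ∈ U) : Good G U z := by
  by_cases hzl : z = l
  · exact hzl ▸ Or.inr (Or.inl ⟨u, hl⟩)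
  by_cases hzu : z = u
  · exact hzu ▸ Or.inr (Or.inr (Or.inl ⟨l, hl⟩))
  have hmem : ∀ w ∈ U, w ≠ l → w ≠ u → w ∈ del G U l := fun w hw h1 h2 =>
    mem_del.2 ⟨hw, h1, fun h => h2 (hl.eq w hw h)⟩
  have hlift : ∀ t s, IsLeaf G (del G U l) t s → ¬ G.Adj u t → IsLeaf G U t s := by
    refine fun t s h hut => ⟨del_subset h.mem, del_subset h.mem', h.adj, fun w hw htw => ?_⟩
    refine h.eq w (hmem w hw ?_ ?_) htw
    · rintro rfl
      exact (mem_del.1 h.mem).2.2 htw.symm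
    · rintro rfl
      exact hut htw.symm
  rcases ih l hl.mem z (hmem z hz hzl hzu) with h | ⟨y, h⟩ | ⟨k, h⟩ | h
  · by_cases hadj : G.Adj z u
    · refine Or.inr (Or.inl ⟨u, hz, hl.mem', hadj, fun w hw hzw => ?_⟩)
      by_contra hwu
      refine h w (hmem w hw ?_ hwu) hzw
      rintro rfl
      exact hzu (hl.eq z hz hzw.symm)
    · refine Or.inl fun w hw hzw => h w (hmem w hw ?_ ?_) hzw
      · rintro rfl
        exact hzu (hl.eq z hz hzw.symm)
      · rintro rfl
        exact hadj hzw
  · by_cases hadj : G.Adj u z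
    · exact Or.inr (Or.inr (Or.inl ⟨y, isLeaf_swap_of_del hG ih hU hl h hadj⟩))
    · exact Or.inr (Or.inl ⟨y, hlift _ _ h hadj⟩)
  · by_cases hadj : G.Adj u k
    · exact Or.inr (Or.inl ⟨k, isLeaf_swap_of_del hG ih hU hl h hadj⟩)
    · exact Or.inr (Or.inr (Or.inl ⟨k, hlift _ _ h hadj⟩))
  · exact Or.inr (Or.inr (Or.inr (h.of_del hG ih hl.mem)))

theorem inSevenCycle_of_neighbors (hG : NoShortCycle G) {c : Fin 7 → V} (hU : ∀ i, c i ∈ U)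
    (hadj : ∀ i, G.Adj (c i) (c (i + 1))) (hne : ∀ i, c i ≠ c (i + 2))
    (hnbr : ∀ i, ∀ w ∈ U, G.Adj (c i) w → w = c (i + 1) ∨ w = c (i + 6)) :
    InSevenCycle G U (c 0) := by
  have hadj1 : ∀ i, G.Adj (c (i + 1)) (c (i + 2)) := fun i => by
    have := hadj (i + 1)
    rwa [add_assoc] at this
  have hadj2 : ∀ i, G.Adj (c (i + 2)) (c (i + 3)) := fun i => by
    have := hadj (i + 2)
    rwa [add_assoc] at this
  have hadj6 : ∀ i, G.Adj (c i) (c (i + 6)) := fun i => by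
    have := hadj (i + 6)
    rw [add_assoc, show (6 + 1 : Fin 7) = 0 from rfl, add_zero] at this
    exact this.symm
  have hne3 : ∀ i, c i ≠ c (i + 3) := fun i h => hG.tri (hadj i) (hadj1 i) (h ▸ (hadj2 i).symm).symm
  -- Residues modulo 7 differ by at most 3 in one direction, so only three distances need to be
  -- checked for injectivity.
  have hsplit : ∀ i j : Fin 7, i = j ∨ j = i + 1 ∨ j = i + 2 ∨ j = i + 3 ∨ i = j + 1 ∨ i = j + 2 ∨
      i = j + 3 := by decide
  refine ⟨c, fun i j hij => ?_, hU, fun i w hw => ⟨hnbr i w hw, ?_⟩, rfl⟩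
  · rcases hsplit i j with h | rfl | rfl | rfl | rfl | rfl | rfl
    · exact h
    · exact absurd hij (hadj i).ne
    · exact absurd hij (hne i)
    · exact absurd hij (hne3 i)
    · exact absurd hij.symm (hadj j).ne
    · exact absurd hij.symm (hne j)
    · exact absurd hij.symm (hne3 j)
  · rintro (rfl | rfl)
    · exact hadj i
    · exact hadj6 i

/-- Without leaves, a vertex at the end of a path of length two has degree two, or lies on a
7-cycle component. -/
theorem exists_unique_other_neighbor (hG : NoShortCycle G)
    (ih : ∀ x ∈ U, ∀ w ∈ del G U x, Good G (del G U x) w) (hnl : ∀ l u, ¬ IsLeaf G U l u)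
    (ha : a ∈ U) (hb : b ∈ U) (hv : v ∈ U) (hab : G.Adj a b) (hbv : G.Adj b v) (hav : a ≠ v)
    (h7 : ¬ InSevenCycle G U v) :
    ∃ d ∈ U, d ≠ b ∧ G.Adj v d ∧ IsLeaf G (del G U a) v d ∧
      ∀ w ∈ U, G.Adj v w → w = b ∨ w = d := by
  have hvW : v ∈ del G U a := mem_del.2 ⟨hv, hav.symm, fun h => hG.tri hab hbv h.symm⟩
  have hanv := (mem_del.1 hvW).2.2
  have hother : ∀ w ∈ U, G.Adj v w → w ≠ b → w ∈ del G U a := by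
    refine fun w hw hvw hwb => mem_del.2 ⟨hw, ?_, fun haw => ?_⟩
    · rintro rfl
      exact hanv hvw.symm
    · exact hwb (hG.quad hab hbv hvw haw.symm hav).symm
  have hleaf : ∀ d, IsLeaf G (del G U a) v d → ∃ d ∈ U, d ≠ b ∧ G.Adj v d ∧
      IsLeaf G (del G U a) v d ∧ ∀ w ∈ U, G.Adj v w → w = b ∨ w = d := by
    refine fun d h => ⟨d, del_subset h.mem', ?_, h.adj, h, fun w hw hvw => ?_⟩
    · rintro rfl
      exact (mem_del.1 h.mem').2.2 hab
    · exact or_iff_not_imp_left.2 fun hwb => h.eq w (hother w hw hvw hwb) hvw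
  rcases ih a ha v hvW with h | ⟨d, h⟩ | ⟨k, h⟩ | h
  · refine absurd ⟨hv, hb, hbv.symm, fun w hw hvw => ?_⟩ (hnl v b)
    by_contra hwb
    exact h w (hother w hw hvw hwb) hvw
  · exact hleaf d h
  -- A leaf `k` at `v` cannot have lost a neighbour in the deletion, because that would close a
  -- 5-cycle through `a`. Hence `k` is already a leaf in `U`.
  · refine absurd ⟨del_subset h.mem, hv, h.adj, fun w hw hkw => ?_⟩ (hnl k v)
    refine h.eq w (mem_del.2 ⟨hw, ?_, fun haw => ?_⟩) hkw
    · rintro rfl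
      exact (mem_del.1 h.mem).2.2 hkw.symm
    · exact hG.pent hab hbv h.adj.symm hkw haw.symm
  · exact absurd (h.of_del hG ih ha) h7

/-- Off the 7-cycle components every relevant vertex has degree two, so the paths `v, u, w, x, y`
and `v, u', w'` are forced. Well-coveredness then closes them with the edge `y w'`. -/
theorem inSevenCycle_of_no_isLeaf (hG : NoShortCycle G)
    (ih : ∀ x ∈ U, ∀ w ∈ del G U x, Good G (del G U x) w) (hU : WellCoveredOn G U)
    (hnl : ∀ l u, ¬ IsLeaf G U l u) (hv : v ∈ U) (hu : u ∈ U) (hvu : G.Adj v u) :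
    InSevenCycle G U v := by
  by_contra h7
  have back : ∀ s t, G.Adj s t → s ∈ U → ¬ InSevenCycle G U s → ¬ InSevenCycle G U t :=
    fun s t hst hs h ht => h (ht.of_adj hs hst.symm)
  have two : ∀ s ∈ U, ∀ t ∈ U, G.Adj s t → ∃ r ∈ U, r ≠ t ∧ G.Adj s r := by
    intro s hs t ht hst
    by_contra! hc
    refine hnl s t ⟨hs, ht, hst, fun w hw hsw => ?_⟩
    by_contra hwt
    exact hc w hw hwt hsw
  have step := @exists_unique_other_neighbor V G U
  obtain ⟨u', hu', hne, hvu'⟩ := two v hv u hu hvu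
  have h7u := back _ _ hvu hv h7
  have h7u' := back _ _ hvu' hv h7
  obtain ⟨w, hw, hwv, huw, -, hunbr⟩ :=
    step hG ih hnl hu' hv hu hvu'.symm hvu hne h7u
  obtain ⟨w', hw', hwv', huw', -, hunbr'⟩ :=
    step hG ih hnl hu hv hu' hvu.symm hvu' hne.symm h7u'
  have h7w := back _ _ huw hu h7u
  have h7w' := back _ _ huw' hu' h7u'
  obtain ⟨x, hx, hxu, hwx, hwleaf, hwnbr⟩ := step hG ih hnl hv hu hw hvu huw hwv.symm h7w
  obtain ⟨x', -, -, -, -, hwnbr'⟩ := step hG ih hnl hv hu' hw' hvu' huw' hwv'.symm h7w'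
  have h7x := back _ _ hwx hw h7w
  obtain ⟨y, hy, hyw, hxy, -, hxnbr⟩ := step hG ih hnl hu hw hx huw hwx hxu.symm h7x
  have h7y := back _ _ hxy hx h7x
  obtain ⟨q, -, -, -, -, hynbr⟩ := step hG ih hnl hw hx hy hwx hxy hyw.symm h7y
  obtain ⟨r, -, -, -, -, hvnbr'⟩ := step hG ih hnl hw hu hv huw.symm hvu.symm hwv h7
  have hvnbr : ∀ t ∈ U, G.Adj v t → t = u ∨ t = u' := by
    intro t ht hvt
    rcases hvnbr' u' hu' hvu' with h | h
    · exact absurd h hne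
    · exact h ▸ hvnbr' t ht hvt
  have hyW : y ∈ del G U v := by
    refine mem_del.2 ⟨hy, ?_, fun hvy => ?_⟩
    · rintro rfl
      exact hG.quad hvu huw hwx hxy hwv.symm |> hxu.symm
    · exact hG.pent hvu huw hwx hxy hvy.symm
  -- After deletion around `v`, the vertex `w` is a leaf at `x`, so `y` is not another one. Hence
  -- `y` has a leaf `k`, which lost a neighbour `u` or `u'` in the deletion; only `k = w'` is
  -- possible.
  have hyw' : G.Adj y w' := by
    rcases ih v hv y hyW with h | ⟨d, h⟩ | ⟨k, h⟩ | h
    · exact absurd hxy.symm (h _ hwleaf.mem')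
    · obtain rfl := h.eq _ hwleaf.mem' hxy.symm
      exact absurd ((hU.del hv).leaf_unique hwleaf h) hyw.symm
    · by_cases hk : ∃ t ∈ U, G.Adj v t ∧ G.Adj k t
      · obtain ⟨t, ht, hvt, hkt⟩ := hk
        have hkv := (mem_del.1 h.mem).2.1
        rcases hvnbr t ht hvt with rfl | rfl
        · rcases hunbr k (del_subset h.mem) hkt.symm with rfl | rfl
          · exact absurd rfl hkv
          · rcases hwnbr y hy h.adj with rfl | rfl
            · exact absurd hvu (mem_del.1 hyW).2.2
            · exact absurd hxy (G.loopless.irrefl _)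
        · rcases hunbr' k (del_subset h.mem) hkt.symm with rfl | rfl
          · exact absurd rfl hkv
          · exact h.adj.symm
      · refine absurd ⟨del_subset h.mem, hy, h.adj, fun t ht hkt => ?_⟩ (hnl k y)
        refine h.eq t (mem_del.2 ⟨ht, ?_, fun hvt => hk ⟨t, ht, hvt, hkt⟩⟩) hkt
        rintro rfl
        exact (mem_del.1 h.mem).2.2 hkt.symm
    · exact absurd (h.of_del hG ih hv) h7y
  have hxw' : x ≠ w' := by
    rintro rfl
    exact hG.pent hvu huw hwx huw'.symm hvu'.symm
  have hyu' : y ≠ u' := by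
    rintro rfl
    exact (mem_del.1 hyW).2.2 hvu'
  have hynbr' : ∀ t ∈ U, G.Adj y t → t = x ∨ t = w' := by
    intro t ht hyt
    rcases hynbr w' hw' hyw' with h | h
    · exact absurd h.symm hxw'
    · exact h ▸ hynbr t ht hyt
  have hwnbr'' : ∀ t ∈ U, G.Adj w' t → t = u' ∨ t = y := by
    intro t ht hwt
    rcases hwnbr' y hy hyw'.symm with h | h
    · exact absurd h hyu'
    · exact h ▸ hwnbr' t ht hwt
  have hcyc := inSevenCycle_of_neighbors (U := U) hG (c := ![v, u, w, x, y, w', u'])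
    (by simp [Fin.forall_fin_succ, *])
    (by
      intro i
      fin_cases i
      exacts [hvu, huw, hwx, hxy, hyw', huw'.symm, hvu'.symm])
    (by
      intro i
      fin_cases i
      exacts [hwv.symm, hxu.symm, hyw.symm, hxw', hyu', hwv', hne])
    (by
      intro i
      fin_cases i
      exacts [hvnbr, fun t ht h => (hunbr t ht h).symm, fun t ht h => (hwnbr t ht h).symm,
        fun t ht h => (hxnbr t ht h).symm, fun t ht h => (hynbr' t ht h).symm, hwnbr'', hunbr'])
  exact h7 hcyc

/-- Every vertex of a well-covered graph without cycles of length at most five is isolated, a leaf,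
next to a leaf, or on a 7-cycle that is a component. -/
theorem good_of_wellCoveredOn (hG : NoShortCycle G) (hU : WellCoveredOn G U) :
    ∀ v ∈ U, Good G U v := by
  induction hn : U.card using Nat.strong_induction_on generalizing U with
  | _ n IH =>
    subst hn
    have ih : ∀ x ∈ U, ∀ w ∈ del G U x, Good G (del G U x) w := fun x hx =>
      IH _ (card_del_lt hx) (hU.del hx) rfl
    intro v hv
    by_cases hl : ∃ l u, IsLeaf G U l u
    · obtain ⟨l, u, hl⟩ := hl
      exact good_of_isLeaf hG ih hU hl hv
    · push Not at hl
      by_cases hiso : ∀ w ∈ U, ¬ G.Adj v w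
      · exact Or.inl hiso
      · push Not at hiso
        obtain ⟨u, hu, hvu⟩ := hiso
        exact Or.inr (Or.inr (Or.inr (inSevenCycle_of_no_isLeaf hG ih hU hl hv hu hvu)))

end Structure

/-! ### The alternating count of stable sets and toggling involutions. -/

section AlternatingSum

variable {V : Type*} [Fintype V] {G : SimpleGraph V}

theorem WellCovered.wellCoveredOn_univ (h : WellCovered G) : WellCoveredOn G Finset.univ := by
  have key : ∀ s, IsMaxStableIn G Finset.univ s → Maximal G.IsIndepSet (s : Set V) := by
    refine fun s hs => ⟨hs.2.1, fun t ht hst x hxt => ?_⟩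
    by_contra hxs
    obtain ⟨y, hy, hxy⟩ := hs.2.2 x (Finset.mem_univ x) hxs
    exact ht hxt (hst hy) hxy.ne hxy
  exact fun s t hs ht => h s t (key s hs) (key t ht)

open Classical in
theorem even_sub_odd_eq_sum :
    (evenStableCount G : ℤ) - oddStableCount G =
      ∑ s ∈ Finset.univ.filter (fun s : Finset V => G.IsIndepSet (s : Set V)), (-1 : ℤ) ^ s.card := by
  rw [← Finset.sum_filter_add_sum_filter_not _ (fun s : Finset V => Even s.card),
    Finset.filter_filter, Finset.filter_filter, Finset.sum_congr rfl (g := fun _ => (1 : ℤ)),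
    Finset.sum_congr (s₁ := Finset.univ.filter fun s : Finset V => G.IsIndepSet (s : Set V) ∧
      ¬ Even s.card) rfl (g := fun _ => (-1 : ℤ))]
  · simp [evenStableCount, oddStableCount, sub_eq_add_neg]
  · intro s hs
    exact (Nat.not_even_iff_odd.1 (Finset.mem_filter.1 hs).2.2).neg_one_pow
  · intro s hs
    exact (Finset.mem_filter.1 hs).2.2.neg_one_pow

open Classical in
theorem eval_indepPoly :
    (indepPoly G).eval (-1) = (evenStableCount G : ℤ) - oddStableCount G := by
  rw [even_sub_odd_eq_sum, indepPoly, Polynomial.eval_finsetSum,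
    ← Finset.sum_fiberwise_of_maps_to (t := Finset.range (G.indepNum + 1))
      (g := fun s : Finset V => s.card)]
  · refine Finset.sum_congr rfl fun k _ => ?_
    rw [Finset.sum_congr rfl (g := fun _ => (-1 : ℤ) ^ k)
      (fun s hs => by rw [(Finset.mem_filter.1 hs).2])]
    simp only [Polynomial.eval_mul, Polynomial.eval_C, Polynomial.eval_pow, Polynomial.eval_X,
      Finset.sum_const, nsmul_eq_mul, stableCount, SimpleGraph.indepSetFinset,
      Finset.filter_filter, SimpleGraph.isNIndepSet_iff]
  · intro s hs
    exact Finset.mem_range_succ_iff.2 (Finset.mem_filter.1 hs).2.card_le_indepNum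

open Classical in
/-- Toggling a vertex chosen by `p` is a parity-reversing involution on the stable sets. -/
theorem even_eq_odd_of_toggle (p : Finset V → V)
    (hp : ∀ s : Finset V, G.IsIndepSet (s : Set V) → ∀ w ∈ s, ¬ G.Adj (p s) w)
    (hpp : ∀ s, p (symmDiff s {p s}) = p s) : evenStableCount G = oddStableCount G := by
  have hsd : ∀ (s : Finset V) (v : V), symmDiff s {v} = if v ∈ s then s.erase v else insert v s := by
    intro s v
    ext w
    by_cases hv : v ∈ s <;> by_cases hw : w = v <;> simp [hv, hw, Finset.mem_symmDiff]
  have hcard : ∀ (s : Finset V) v, (-1 : ℤ) ^ s.card + (-1) ^ (symmDiff s {v}).card = 0 := by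
    intro s v
    rw [hsd]
    split_ifs with hv
    · rw [← Finset.card_erase_add_one hv, pow_succ]
      ring
    · rw [Finset.card_insert_of_notMem hv, pow_succ]
      ring
  have h0 : (evenStableCount G : ℤ) - oddStableCount G = 0 := by
    rw [even_sub_odd_eq_sum]
    refine Finset.sum_involution (fun s _ => symmDiff s {p s}) (fun s _ => hcard s _) ?_ ?_ ?_
    · intro s _ _ h
      have := Finset.ext_iff.1 h (p s)
      by_cases hs : p s ∈ s <;> simp [Finset.mem_symmDiff, hs] at this
    · intro s hs
      have hs := (Finset.mem_filter.1 hs).2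
      refine Finset.mem_filter.2 ⟨Finset.mem_univ _, ?_⟩
      rw [hsd]
      split_ifs with hv
      · exact hs.mono (by simp)
      · exact isIndepSet_insert hs (hp s hs)
    · intro s _
      simp only [hpp]
      rw [symmDiff_assoc, symmDiff_self, symmDiff_bot]
  exact_mod_cast sub_eq_zero.1 h0

theorem even_eq_odd_of_isolated {v : V} (h : ∀ w, ¬ G.Adj v w) :
    evenStableCount G = oddStableCount G := by
  classical
  exact even_eq_odd_of_toggle (fun _ => v) (fun _ _ w _ => h w) fun _ => rfl

theorem even_eq_odd_of_adj_leaf {l u y k : V} (hl : IsLeaf G Finset.univ l u) (huy : G.Adj u y)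
    (hk : IsLeaf G Finset.univ k y) (hku : k ≠ u) : evenStableCount G = oddStableCount G := by
  classical
  refine even_eq_odd_of_toggle (fun s => if u ∈ s then k else l) (fun s hs w hw hadj => ?_)
    fun s => ?_
  · split_ifs at hadj with hu
    · obtain rfl := hk.eq w (Finset.mem_univ w) hadj
      exact hs hu hw huy.ne huy
    · exact hu (hl.eq w (Finset.mem_univ w) hadj ▸ hw)
  -- The toggled vertex is never `u`, so the choice between `k` and `l` is unaffected by the toggle.
  · have : u ∈ symmDiff s {if u ∈ s then k else l} ↔ u ∈ s := by
      split_ifs with hu <;> simp [Finset.mem_symmDiff, hu, hku.symm, hl.adj.ne.symm]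
    simp only [this]

theorem even_eq_odd_or_components (hG : WellCovered G) (hgood : ∀ v, Good G Finset.univ v) :
    evenStableCount G = oddStableCount G ∨ ∀ v, InSevenCycle G Finset.univ v ∨
      ∃ u, IsLeaf G Finset.univ v u ∧ IsLeaf G Finset.univ u v := by
  by_cases h : evenStableCount G = oddStableCount G
  · exact Or.inl h
  refine Or.inr fun v => ?_
  -- Another neighbour `y` of `u` would contradict every case of `Good`: a second leaf at `u`, an
  -- available toggle, or a leaf on a 7-cycle component.
  have key : ∀ l u, IsLeaf G Finset.univ l u → IsLeaf G Finset.univ u l := by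
    refine fun l u hl => ⟨hl.mem', hl.mem, hl.adj.symm, fun y hy huy => ?_⟩
    by_contra hyl
    rcases hgood y with hy | ⟨t, ht⟩ | ⟨k, hk⟩ | hy
    · exact hy u hl.mem' huy.symm
    · obtain rfl := ht.eq u hl.mem' huy.symm
      exact hyl (hG.wellCoveredOn_univ.leaf_unique ht hl)
    · refine h (even_eq_odd_of_adj_leaf hl huy hk ?_)
      rintro rfl
      exact hyl (hk.eq l hl.mem hl.adj.symm).symm
    · exact ((hy.of_adj hl.mem' huy.symm).of_adj hl.mem hl.adj.symm).not_isLeaf hl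
  rcases hgood v with hv | ⟨u, hu⟩ | ⟨l, hl⟩ | hv
  · exact absurd (even_eq_odd_of_isolated fun w => hv w (Finset.mem_univ w)) h
  · exact Or.inr ⟨u, hu, key _ _ hu⟩
  · exact Or.inr ⟨l, key _ _ hl, hl⟩
  · exact Or.inl hv

end AlternatingSum

/-! ### Perfect matchings and leaves in very well-covered graphs. -/

section VeryWellCovered

variable {V : Type*} [Fintype V] {G : SimpleGraph V}

open Classical in
/-- The vertices with a neighbour in `s`. -/
noncomputable def nbhd (G : SimpleGraph V) (s : Finset V) : Finset V :=
  Finset.univ.filter fun v => ∃ w ∈ s, G.Adj w v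

theorem mem_nbhd {s : Finset V} {v : V} : v ∈ nbhd G s ↔ ∃ w ∈ s, G.Adj w v := by simp [nbhd]

/-- In a well-covered graph without isolated vertices, a stable set has at least as many
neighbours as elements. -/
theorem WellCovered.card_le_card_nbhd (hG : WellCovered G) (hiso : ∀ v, ∃ w, G.Adj v w)
    {s : Finset V} (hs : G.IsIndepSet (s : Set V)) : s.card ≤ (nbhd G s).card := by
  classical
  induction s using Finset.strongInduction with
  | H s ih =>
    by_contra! hlt
    obtain ⟨v, hv⟩ := Finset.card_pos.1 (Nat.zero_lt_of_lt hlt)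
    obtain ⟨x, hvx⟩ := hiso v
    obtain ⟨J, hxJ, hJ⟩ := exists_isMaxStableIn (G := G) (U := Finset.univ) (t := {x})
      (Finset.subset_univ _) (by simp)
    have hxJ : x ∈ J := hxJ (Finset.mem_singleton_self x)
    -- For a minimal violating `s`, exchanging `K` for `s` in `J` yields `s.card ≤ K.card + A.card`.
    -- Minimality bounds `A.card` by the number of neighbours of `s` outside `K`.
    let K := J ∩ nbhd G s
    let A := s \ nbhd G K
    have hvA : v ∉ A := fun h => (Finset.mem_sdiff.1 h).2 (mem_nbhd.2
      ⟨x, Finset.mem_inter.2 ⟨hxJ, mem_nbhd.2 ⟨v, hv, hvx⟩⟩, hvx.symm⟩)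
    have hAs : A ⊂ s := ⟨Finset.sdiff_subset, fun h => hvA (h hv)⟩
    have hA := ih A hAs (hs.mono (by exact_mod_cast hAs.1))
    have hNA : nbhd G A ⊆ nbhd G s \ K := by
      intro w hw
      obtain ⟨a, ha, haw⟩ := mem_nbhd.1 hw
      refine Finset.mem_sdiff.2 ⟨mem_nbhd.2 ⟨a, hAs.1 ha, haw⟩, fun hwK => ?_⟩
      exact (Finset.mem_sdiff.1 ha).2 (mem_nbhd.2 ⟨w, hwK, haw.symm⟩)
    have h1 := Finset.card_le_card hNA
    have h2 : (nbhd G s \ K).card + K.card = (nbhd G s).card :=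
      Finset.card_sdiff_add_card_eq_card (Finset.inter_subset_right : K ⊆ nbhd G s)
    have h3 : (J \ nbhd G s).card + K.card = J.card := Finset.card_sdiff_add_card_inter J (nbhd G s)
    have hJs : J ∩ s ⊆ A := by
      intro a ha
      obtain ⟨haJ, has⟩ := Finset.mem_inter.1 ha
      refine Finset.mem_sdiff.2 ⟨has, fun h => ?_⟩
      obtain ⟨k, hk, hka⟩ := mem_nbhd.1 h
      exact hJ.2.1 (Finset.mem_inter.1 hk).1 haJ hka.ne hka
    have h4 := Finset.card_le_card hJs
    have hind : G.IsIndepSet (((J \ nbhd G s) ∪ s : Finset V) : Set V) := by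
      have hno : ∀ a ∈ J \ nbhd G s, ∀ b ∈ s, ¬ G.Adj a b := fun a ha b hb hab =>
        (Finset.mem_sdiff.1 ha).2 (mem_nbhd.2 ⟨b, hb, hab.symm⟩)
      intro a ha b hb hab hadj
      rcases Finset.mem_union.1 (Finset.mem_coe.1 ha) with ha | ha <;>
        rcases Finset.mem_union.1 (Finset.mem_coe.1 hb) with hb | hb
      · exact hJ.2.1 (Finset.mem_sdiff.1 ha).1 (Finset.mem_sdiff.1 hb).1 hab hadj
      · exact hno a ha b hb hadj
      · exact hno b hb a ha hadj.symm
      · exact hs ha hb hab hadj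
    have h5 := hG.wellCoveredOn_univ.card_le (Finset.subset_univ _) hind hJ
    have h6 := Finset.card_union_add_card_inter (J \ nbhd G s) s
    have h7 := Finset.card_le_card (show (J \ nbhd G s) ∩ s ⊆ J ∩ s from
      Finset.inter_subset_inter_right Finset.sdiff_subset)
    omega

/-- A very well-covered graph has a perfect matching; `g` sends each edge of the matching to a
point. -/
theorem VeryWellCovered.exists_matching (hG : VeryWellCovered G) :
    ∃ (S : Finset V) (g : V → V), S.card = G.indepNum ∧ (∀ v, g v ∈ S) ∧
      ∀ v, ∃ m, G.Adj v m ∧ ∀ w, g w = g v → w = v ∨ w = m := by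
  classical
  obtain ⟨S, hS⟩ := G.exists_isNIndepSet_indepNum
  -- Hall's condition for a maximum stable set `S` is `WellCovered.card_le_card_nbhd`. As the order
  -- is twice `S.card`, the resulting injection fills the complement of `S`.
  have hall : ∃ f : {x // x ∈ S} → V, Function.Injective f ∧ ∀ x, f x ∈ nbhd G {x.1} := by
    rw [← Finset.all_card_le_biUnion_card_iff_exists_injective]
    intro A
    have := hG.1.card_le_card_nbhd hG.2.1 (s := A.map (Function.Embedding.subtype _))
      (hS.1.mono (by intro x; simp +contextual))
    rw [Finset.card_map] at this
    refine this.trans (Finset.card_le_card fun v hv => ?_)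
    obtain ⟨w, hw, hwv⟩ := mem_nbhd.1 hv
    obtain ⟨a, ha, rfl⟩ := Finset.mem_map.1 hw
    exact Finset.mem_biUnion.2 ⟨a, ha, mem_nbhd.2 ⟨a, by simp, hwv⟩⟩
  obtain ⟨f, hf, hadj⟩ := hall
  have hadj : ∀ x, G.Adj x.1 (f x) := fun x => by simpa [mem_nbhd] using hadj x
  have hfS : ∀ x, f x ∉ S := fun x hx => hS.1 x.2 hx (hadj x).ne (hadj x)
  have hsurj : ∀ v, v ∉ S → ∃ x, f x = v := by
    have himg : Finset.univ.image f = Sᶜ := by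
      refine Finset.eq_of_subset_of_card_le (fun v hv => ?_) ?_
      · obtain ⟨x, -, rfl⟩ := Finset.mem_image.1 hv
        exact Finset.mem_compl.2 (hfS x)
      · rw [Finset.card_image_of_injective _ hf, Finset.card_compl, hG.2.2, hS.2]
        simp [hS.2]
        omega
    intro v hv
    obtain ⟨x, -, hx⟩ := Finset.mem_image.1 (himg ▸ Finset.mem_compl.2 hv)
    exact ⟨x, hx⟩
  choose r hr using hsurj
  refine ⟨S, fun v => if h : v ∈ S then v else (r v h).1, hS.2, fun v => ?_, fun v => ?_⟩
  · by_cases h : v ∈ S <;> simp [h]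
  · by_cases hv : v ∈ S
    · refine ⟨f ⟨v, hv⟩, hadj ⟨v, hv⟩, fun w hw => ?_⟩
      by_cases hwS : w ∈ S
      · simp only [hv, hwS, dite_true] at hw
        exact Or.inl hw
      · simp only [hv, hwS, dite_true, dite_false] at hw
        exact Or.inr (by rw [← hr w hwS]; exact congrArg f (Subtype.ext hw))
    · refine ⟨(r v hv).1, ?_, fun w hw => ?_⟩
      · have := hadj (r v hv)
        rw [hr] at this
        exact this.symm
      by_cases hwS : w ∈ S
      · simp only [hv, hwS, dite_true, dite_false] at hw
        exact Or.inr hw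
      · simp only [hv, hwS, dite_false] at hw
        exact Or.inl (by rw [← hr w hwS, ← hr v hv]; exact congrArg f (Subtype.ext hw))

/-- If neither end of the matching edge `v m` is a leaf, take further neighbours `a` of `v` and `b`
of `m`, non-adjacent for lack of a 4-cycle. A maximal stable set containing both misses that edge
and meets every other at most once, so it is too small. -/
theorem VeryWellCovered.isLeaf_or (hG : VeryWellCovered G) (hg : 5 ≤ G.egirth) (v : V) :
    (∃ u, IsLeaf G Finset.univ v u) ∨ ∃ l, IsLeaf G Finset.univ l v := by
  classical
  obtain ⟨S, g, hS, hgS, hmatch⟩ := hG.exists_matching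
  obtain ⟨m, hvm, hm⟩ := hmatch v
  by_contra! hc
  have hv : ∃ a, G.Adj v a ∧ a ≠ m := by
    by_contra! h
    exact hc.1 m ⟨Finset.mem_univ _, Finset.mem_univ _, hvm, fun w _ => h w⟩
  have hm' : ∃ b, G.Adj m b ∧ b ≠ v := by
    by_contra! h
    exact hc.2 m ⟨Finset.mem_univ _, Finset.mem_univ _, hvm.symm, fun w _ => h w⟩
  obtain ⟨a, hva, ham⟩ := hv
  obtain ⟨b, hmb, hbv⟩ := hm'
  have hnab : ¬ G.Adj a b := fun h =>
    ham (eq_of_five_le_egirth hg hvm hmb h.symm hva.symm hbv.symm).symm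
  obtain ⟨J, hJ, hmax⟩ := exists_isMaxStableIn (G := G) (U := Finset.univ) (t := {a, b})
    (Finset.subset_univ _) (isIndepSet_insert (by simp) (by simpa using hnab))
  have haJ : a ∈ J := hJ (by simp)
  have hbJ : b ∈ J := hJ (by simp)
  have hle : J.card ≤ (S.erase (g v)).card := by
    refine Finset.card_le_card_of_injOn g (fun j hj => ?_) (fun i hi j hj hij => ?_)
    · refine Finset.mem_erase.2 ⟨fun h => ?_, hgS j⟩
      rcases hm j h with rfl | rfl
      · exact hmax.2.1 hj haJ hva.ne hva
      · exact hmax.2.1 hj hbJ hmb.ne hmb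
    · obtain ⟨k, hjk, hk⟩ := hmatch j
      rcases hk i hij with rfl | rfl
      · rfl
      · exact absurd hjk (hmax.2.1 hj hi hjk.ne)
  obtain ⟨T, hT⟩ := G.exists_isNIndepSet_indepNum
  have h1 := hG.1.wellCoveredOn_univ.card_le (Finset.subset_univ T) hT.1 hmax
  rw [hT.2] at h1
  have h2 := Finset.card_erase_lt_of_mem (hgS v)
  omega

end VeryWellCovered

/-! ### Recognising components and assembling disjoint unions of copies. -/

section Components

variable {V W ι : Type*} {G : SimpleGraph V} {H : SimpleGraph W}

/-- The hypothesis `hf` makes the image of `f` closed under adjacency, so no walk leaves it, while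
connectedness of `H` keeps it in one component. -/
theorem range_eq_supp (hH : H.Preconnected) {f : W → V}
    (hf : ∀ i w, G.Adj (f i) w ↔ ∃ j, H.Adj i j ∧ f j = w) (i₀ : W) :
    Set.range f = (G.connectedComponentMk (f i₀)).supp := by
  ext v
  rw [SimpleGraph.ConnectedComponent.mem_supp_iff, SimpleGraph.ConnectedComponent.eq]
  constructor
  · rintro ⟨i, rfl⟩
    let φ : H →g G := ⟨f, fun {a b} h => (hf a _).2 ⟨b, h, rfl⟩⟩
    exact (hH i i₀).map φ
  · rintro h
    obtain ⟨p⟩ := h.symm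
    have key : ∀ a b, G.Walk a b → a ∈ Set.range f → b ∈ Set.range f := by
      intro a b p
      induction p with
      | nil => exact id
      | cons h _ ih =>
        rintro ⟨i, rfl⟩
        obtain ⟨j, -, rfl⟩ := (hf i _).1 h
        exact ih ⟨j, rfl⟩
    exact key _ _ p ⟨i₀, rfl⟩

theorem adj_iff_of_neighbors {f : W → V} (hinj : Function.Injective f)
    (hf : ∀ i w, G.Adj (f i) w ↔ ∃ j, H.Adj i j ∧ f j = w) (a b : W) :
    G.Adj (f a) (f b) ↔ H.Adj a b := by
  rw [hf]
  constructor
  · rintro ⟨j, hj, h⟩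
    exact hinj h ▸ hj
  · exact fun h => ⟨b, h, rfl⟩

theorem nonempty_component_iso (hH : H.Preconnected) {f : W → V} (hinj : Function.Injective f)
    (hf : ∀ i w, G.Adj (f i) w ↔ ∃ j, H.Adj i j ∧ f j = w) (i₀ : W) :
    Nonempty ((G.connectedComponentMk (f i₀)).toSimpleGraph ≃g H) := by
  have hr := range_eq_supp hH hf i₀
  let e : W ≃ (G.connectedComponentMk (f i₀)) := Equiv.ofBijective
    (fun a => ⟨f a, hr.subset ⟨a, rfl⟩⟩) ⟨fun a b h => hinj (congrArg Subtype.val h), by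
      rintro ⟨v, hv⟩
      obtain ⟨a, rfl⟩ : v ∈ Set.range f := hr ▸ hv
      exact ⟨a, rfl⟩⟩
  have hadj := adj_iff_of_neighbors hinj hf
  exact ⟨SimpleGraph.Iso.symm ⟨e, fun {a b} => hadj a b⟩⟩

/-- The disjoint union of components isomorphic to `H`, embedded in `G`. -/
def componentMap (c : ι → G.ConnectedComponent) (e : ∀ i, (c i).toSimpleGraph ≃g H) :
    ι × W → V := fun x => ((e x.1).symm x.2).1

theorem connectedComponentMk_componentMap (c : ι → G.ConnectedComponent)
    (e : ∀ i, (c i).toSimpleGraph ≃g H) (x : ι × W) :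
    G.connectedComponentMk (componentMap c e x) = c x.1 := ((e x.1).symm x.2).2

theorem componentMap_injective {c : ι → G.ConnectedComponent} (hc : Function.Injective c)
    (e : ∀ i, (c i).toSimpleGraph ≃g H) : Function.Injective (componentMap c e) := by
  rintro ⟨i, a⟩ ⟨j, b⟩ h
  obtain rfl : i = j := hc (by
    rw [← connectedComponentMk_componentMap c e ⟨i, a⟩, h, connectedComponentMk_componentMap])
  have : a = b := (e i).symm.injective (Subtype.ext h)
  rw [this]

theorem adj_componentMap {c : ι → G.ConnectedComponent} (hc : Function.Injective c)
    (e : ∀ i, (c i).toSimpleGraph ≃g H) (x y : ι × W) :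
    G.Adj (componentMap c e x) (componentMap c e y) ↔ x.1 = y.1 ∧ H.Adj x.2 y.2 := by
  obtain ⟨i, a⟩ := x
  obtain ⟨j, b⟩ := y
  have key : ∀ b, G.Adj (componentMap c e (i, a)) (componentMap c e (i, b)) ↔ H.Adj a b :=
    fun b => (e i).symm.map_rel_iff (a := a) (b := b)
  constructor
  · intro h
    obtain rfl : i = j := hc (by
      rw [← connectedComponentMk_componentMap c e ⟨i, a⟩,
        ← connectedComponentMk_componentMap c e ⟨j, b⟩]
      exact SimpleGraph.ConnectedComponent.connectedComponentMk_eq_of_adj h)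
    exact ⟨rfl, (key b).1 h⟩
  · rintro ⟨h, hab⟩
    obtain rfl : i = j := h
    exact (key b).2 hab

theorem exists_componentMap_eq (c : ι → G.ConnectedComponent)
    (e : ∀ i, (c i).toSimpleGraph ≃g H) {v : V} {i : ι} (hv : G.connectedComponentMk v = c i) :
    ∃ x, componentMap c e x = v :=
  ⟨(i, e i ⟨v, hv⟩), by simp [componentMap]⟩

theorem exists_iso_copies [Finite V] [Nonempty V]
    (h : ∀ C : G.ConnectedComponent, Nonempty (C.toSimpleGraph ≃g H)) :
    ∃ q, 1 ≤ q ∧ Nonempty (G ≃g copies q H) := by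
  obtain ⟨q, ⟨i⟩⟩ := Finite.exists_equiv_fin G.ConnectedComponent
  have e : ∀ k, (i.symm k).toSimpleGraph ≃g H := fun k => (h _).some
  have hc : Function.Injective i.symm := i.symm.injective
  refine ⟨q, (Nat.zero_le _).trans_lt (i (G.connectedComponentMk (Classical.arbitrary V))).2,
    ⟨SimpleGraph.Iso.symm ⟨Equiv.ofBijective (componentMap _ e) ⟨componentMap_injective hc e,
      fun v => exists_componentMap_eq _ e (i := i (G.connectedComponentMk v)) (by simp)⟩,
      fun {a b} => adj_componentMap hc e a b⟩⟩⟩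

theorem exists_iso_copies_sum [Finite V] [Nonempty V] {W' : Type*} {H' : SimpleGraph W'}
    (h : ∀ C : G.ConnectedComponent,
      Nonempty (C.toSimpleGraph ≃g H) ∨ Nonempty (C.toSimpleGraph ≃g H')) :
    ∃ p q, 1 ≤ p + q ∧ Nonempty (G ≃g (copies p H ⊕g copies q H')) := by
  let P : G.ConnectedComponent → Prop := fun C => Nonempty (C.toSimpleGraph ≃g H)
  obtain ⟨p, ⟨i⟩⟩ := Finite.exists_equiv_fin {C // P C}
  obtain ⟨q, ⟨j⟩⟩ := Finite.exists_equiv_fin {C // ¬ P C}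
  let c : Fin p → G.ConnectedComponent := fun k => (i.symm k).1
  let d : Fin q → G.ConnectedComponent := fun k => (j.symm k).1
  have hc : Function.Injective c := Subtype.val_injective.comp i.symm.injective
  have hd : Function.Injective d := Subtype.val_injective.comp j.symm.injective
  have hcd : ∀ k l, c k ≠ d l := fun k l hkl => (j.symm l).2 (by
    have := (i.symm k).2
    rwa [show (i.symm k).1 = (j.symm l).1 from hkl] at this)
  have e : ∀ k, (c k).toSimpleGraph ≃g H := fun k => (i.symm k).2.some
  have e' : ∀ k, (d k).toSimpleGraph ≃g H' := fun k => ((h _).resolve_left (j.symm k).2).some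
  have hne : ∀ x y, G.connectedComponentMk (componentMap c e x) ≠
      G.connectedComponentMk (componentMap d e' y) := fun x y => by
    rw [connectedComponentMk_componentMap, connectedComponentMk_componentMap]
    exact hcd _ _
  have hnadj : ∀ x y, ¬ G.Adj (componentMap c e x) (componentMap d e' y) := fun x y hadj =>
    hne x y (SimpleGraph.ConnectedComponent.connectedComponentMk_eq_of_adj hadj)
  have hcov : ∀ v, (∃ x, componentMap c e x = v) ∨ ∃ x, componentMap d e' x = v := by
    intro v
    by_cases hP : P (G.connectedComponentMk v)
    · exact Or.inl (exists_componentMap_eq c e (i := i ⟨_, hP⟩) (by simp [c]))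
    · exact Or.inr (exists_componentMap_eq d e' (i := j ⟨_, hP⟩) (by simp [d]))
  have hbij : Function.Bijective (Sum.elim (componentMap c e) (componentMap d e')) := by
    refine ⟨(componentMap_injective hc e).sumElim (componentMap_injective hd e')
      fun x y hxy => hne x y (congrArg _ hxy), fun v => ?_⟩
    rcases hcov v with ⟨x, hx⟩ | ⟨x, hx⟩
    · exact ⟨Sum.inl x, hx⟩
    · exact ⟨Sum.inr x, hx⟩
  refine ⟨p, q, ?_, ⟨SimpleGraph.Iso.symm ⟨Equiv.ofBijective _ hbij, ?_⟩⟩⟩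
  · rcases hcov (Classical.arbitrary V) with ⟨x, -⟩ | ⟨x, -⟩
    · have := x.1.2
      omega
    · have := x.1.2
      omega
  · rintro (x | x) (y | y)
    · exact adj_componentMap hc e x y
    · simpa using hnadj x y
    · simpa using fun hadj => hnadj y x hadj.symm
    · exact adj_componentMap hd e' x y

theorem pair_injective {v u : V} (h : v ≠ u) : Function.Injective ![v, u] := by
  intro i j hij
  fin_cases i <;> fin_cases j <;> simp_all

end Components

/-! ### Components `K₂` and `C₇`, and the conclusion. -/

section Classification

variable {V : Type*} [Fintype V] {G : SimpleGraph V} {v u : V}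

theorem adj_pair_iff (h : IsLeaf G Finset.univ v u) (h' : IsLeaf G Finset.univ u v) (i : Fin 2)
    (w : V) : G.Adj (![v, u] i) w ↔ ∃ j, (SimpleGraph.completeGraph (Fin 2)).Adj i j ∧ ![v, u] j = w := by
  have h1 : G.Adj v w ↔ u = w :=
    ⟨fun hw => (h.eq w (Finset.mem_univ w) hw).symm, fun hw => hw ▸ h.adj⟩
  have h2 : G.Adj u w ↔ v = w :=
    ⟨fun hw => (h'.eq w (Finset.mem_univ w) hw).symm, fun hw => hw ▸ h'.adj⟩
  fin_cases i <;> simp [Fin.exists_fin_two, h1, h2]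

theorem nonempty_component_iso_completeGraph (h : IsLeaf G Finset.univ v u)
    (h' : IsLeaf G Finset.univ u v) :
    Nonempty ((G.connectedComponentMk v).toSimpleGraph ≃g SimpleGraph.completeGraph (Fin 2)) :=
  nonempty_component_iso SimpleGraph.connected_top.preconnected (pair_injective h.adj.ne)
    (adj_pair_iff h h') 0

theorem InSevenCycle.exists_map (h : InSevenCycle G Finset.univ v) :
    ∃ c : Fin 7 → V, Function.Injective c ∧ c 0 = v ∧
      ∀ i w, G.Adj (c i) w ↔ ∃ j, (SimpleGraph.cycleGraph 7).Adj i j ∧ c j = w := by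
  obtain ⟨c, hinj, -, hc, h0⟩ := h
  have hadj : ∀ i j : Fin 7, (SimpleGraph.cycleGraph 7).Adj i j ↔ j = i + 1 ∨ j = i + 6 := by
    decide
  refine ⟨c, hinj, h0, fun i w => ?_⟩
  simp only [hc i w (Finset.mem_univ w), hadj, or_and_right, exists_or, exists_eq_left, eq_comm]

theorem InSevenCycle.nonempty_component_iso (h : InSevenCycle G Finset.univ v) :
    Nonempty ((G.connectedComponentMk v).toSimpleGraph ≃g SimpleGraph.cycleGraph 7) := by
  obtain ⟨c, hinj, rfl, hc⟩ := h.exists_map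
  exact StableSets.nonempty_component_iso SimpleGraph.cycleGraph_preconnected hinj hc 0

theorem InSevenCycle.not_isAcyclic (h : InSevenCycle G Finset.univ v) : ¬ G.IsAcyclic := by
  obtain ⟨c, hinj, -, hc⟩ := h.exists_map
  let φ : SimpleGraph.cycleGraph 7 →g G := ⟨c, fun {a b} h => (hc a _).2 ⟨b, h, rfl⟩⟩
  exact fun hG => hG.comap φ hinj _ (SimpleGraph.cycleGraph.isCycle_cycle (n := 4))

theorem nonempty_iso_completeGraph (hconn : G.Preconnected) (h : IsLeaf G Finset.univ v u)
    (h' : IsLeaf G Finset.univ u v) : Nonempty (G ≃g SimpleGraph.completeGraph (Fin 2)) := by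
  have hr := range_eq_supp SimpleGraph.connected_top.preconnected (adj_pair_iff h h') 0
  have hinj := pair_injective h.adj.ne
  refine ⟨SimpleGraph.Iso.symm ⟨Equiv.ofBijective ![v, u] ⟨hinj, fun w => ?_⟩,
    fun {a b} => adj_iff_of_neighbors hinj (adj_pair_iff h h') a b⟩⟩
  change w ∈ Set.range _
  rw [hr]
  exact SimpleGraph.ConnectedComponent.sound (hconn w _)

theorem even_eq_odd_or_of_six_le_egirth (hG : WellCovered G) (hg : 6 ≤ G.egirth) :
    evenStableCount G = oddStableCount G ∨ ∀ v, InSevenCycle G Finset.univ v ∨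
      ∃ u, IsLeaf G Finset.univ v u ∧ IsLeaf G Finset.univ u v :=
  even_eq_odd_or_components hG fun v => good_of_wellCoveredOn (noShortCycle_of_six_le_egirth hg)
    hG.wellCoveredOn_univ v (Finset.mem_univ v)

theorem eval_eq_zero_and (h : evenStableCount G = oddStableCount G) :
    (indepPoly G).eval (-1) = 0 ∧ evenStableCount G = oddStableCount G :=
  ⟨by rw [eval_indepPoly, h, sub_self], h⟩

end Classification

end StableSets

open StableSets SimpleGraph in
theorem mainTheorem3 {V : Type*} [Fintype V] [Nonempty V] (G : SimpleGraph V) :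
    (WellCovered G → 6 ≤ G.egirth →
      (∀ p q : ℕ, 1 ≤ p + q →
        ¬ Nonempty (G ≃g (copies p (completeGraph (Fin 2)) ⊕g copies q (cycleGraph 7)))) →
      (indepPoly G).eval (-1) = 0 ∧ evenStableCount G = oddStableCount G) ∧
    (VeryWellCovered G → 5 ≤ G.egirth →
      (∀ q : ℕ, 1 ≤ q → ¬ Nonempty (G ≃g copies q (completeGraph (Fin 2)))) →
      (indepPoly G).eval (-1) = 0 ∧ evenStableCount G = oddStableCount G) ∧
    (G.IsTree → WellCovered G → ¬ Nonempty (G ≃g completeGraph (Fin 2)) →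
      (indepPoly G).eval (-1) = 0 ∧ evenStableCount G = oddStableCount G) := by
  refine ⟨fun hG hg hne => ?_, fun hG hg hne => ?_, fun hT hG hne => ?_⟩
  · rcases even_eq_odd_or_of_six_le_egirth hG hg with h | h
    · exact eval_eq_zero_and h
    obtain ⟨p, q, hpq, hiso⟩ := exists_iso_copies_sum (G := G) (H := completeGraph (Fin 2))
      (H' := cycleGraph 7) fun C => by
        induction C using ConnectedComponent.ind with
        | _ v =>
          rcases h v with h | ⟨u, h, h'⟩
          · exact Or.inr h.nonempty_component_iso
          · exact Or.inl (nonempty_component_iso_completeGraph h h')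
    exact absurd hiso (hne p q hpq)
  · have hleaf := hG.isLeaf_or hg
    rcases even_eq_odd_or_components hG.1 fun v => (hleaf v).elim (Or.inr ∘ Or.inl)
      (Or.inr ∘ Or.inr ∘ Or.inl) with h | h
    · exact eval_eq_zero_and h
    obtain ⟨q, hq, hiso⟩ := exists_iso_copies (G := G) (H := completeGraph (Fin 2)) fun C => by
      induction C using ConnectedComponent.ind with
      | _ v =>
        rcases h v with h | ⟨u, h, h'⟩
        -- A 7-cycle component contains no leaf and no neighbour of a leaf.
        · rcases hleaf v with ⟨u, hu⟩ | ⟨l, hl⟩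
          · exact absurd hu h.not_isLeaf
          · exact absurd hl (h.of_adj hl.mem hl.adj.symm).not_isLeaf
        · exact nonempty_component_iso_completeGraph h h'
    exact absurd hiso (hne q hq)
  · have hg : 6 ≤ G.egirth := by
      rw [egirth_eq_top.2 hT.2]
      exact le_top
    rcases even_eq_odd_or_of_six_le_egirth hG hg with h | h
    · exact eval_eq_zero_and h
    rcases h (Classical.arbitrary V) with h | ⟨u, h, h'⟩
    · exact absurd hT.2 h.not_isAcyclic
    · exact absurd (nonempty_iso_completeGraph hT.1.preconnected h h') hne
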